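/- Let $\Gamma$ be a finite Abelian group (written additively). A $\Gamma$-magic rectangle set $\mathrm{MRS}_\Gamma(a,b;c)$ is a collection of $c$ arrays of size $a\times b$ (that is, $a$ rows and $b$ columns) whose entries are elements of $\Gamma$, each element of $\Gamma$ appearing exactly once in the whole collection (so $|\Gamma|=abc$), such that there are constants $\omega,\delta\in\Gamma$ with every row sum of every array equal to $\omega$ and every column sum of every array equal to $\delta$. Let $a>1$ be odd, let $\alpha,\beta,m\ge 0$ be integers with $b=2^{\alpha}>2$, and let $c=2^{\beta}(2m+1)$. Let $k>1$, let $1\le\alpha_1\le\alpha_2\le\dots\le\alpha_k$ be integers with $\sum_{i=1}^k\alpha_i=\alpha+\beta$, let $\Delta$ be an Abelian group of (odd) order $a(2m+1)$, and let $$\Gamma\cong\Delta\times\mathbb{Z}_{2^{\alpha_1}}\times\mathbb{Z}_{2^{\alpha_2}}\times\dots\times\mathbb{Z}_{2^{\alpha_k}}.$$ Then a $\Gamma$-magic rectangle set $\mathrm{MRS}_\Gamma(a,2^{\alpha};c)$ exists if at least one of the following conditions holds: 1. $\alpha_1>1$; 2. $k\ge 3$ and $\alpha_3>1$; 3. $k>3$;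 4. $c$ is odd. -/

import Mathlib

/-- A `Γ`-magic rectangle set of `c` arrays with `a` rows and `b` columns: every element of the
Abelian group `Γ` occurs exactly once as an entry (so `Γ` has order `a * b * c`), and all row sums
(respectively all column sums) of all the `c` rectangles are equal to one and the same constant. -/
structure MagicRectangleSet (Γ : Type*) [AddCommGroup Γ] (a b c : ℕ) where
  /-- `entry s i j` is the entry in row `i` and column `j` of the `s`-th rectangle. -/
  entry : Fin c → Fin a → Fin b → Γ
  /-- Every group element appears exactly once. -/
  existsUnique_entry : ∀ g : Γ, ∃! t : Fin c × Fin a × Fin b, entry t.1 t.2.1 t.2.2 = g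
  /-- The common row sum. -/
  rowConst : Γ
  /-- The common column sum. -/
  colConst : Γ
  row_sum : ∀ s i, ∑ j, entry s i j = rowConst
  col_sum : ∀ s j, ∑ i, entry s i j = colConst

open Finset

/-! All row and column sums can be made zero. Write `P` for the 2-part of the group. The argument
rests on splitting `Δ × P` into pieces that are tiled separately and on lifting tilings from
quotients.

The odd factor `2m+1` is removed by passing to `Δ ⧸ K` with `K` of that order: a zero-sum array over
a quotient lifts to a zero-sum array (`exists_lift_array`), and the lifts are shifted by multiples
of elements of `K` whose coefficients cancel along rows and columns (`IsTiled.of_odd_kernel`).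

When `Δ` has order `a`, its elements label the rows in bulk. For `d ≠ 0` the set `{d, -d} × P` is
cut into `2 × 4` arrays whose two rows are negatives of each other; this needs only that `P` maps
onto the Klein four-group, that is, that `P` is noncyclic (`IsTiled.pair`). Since `a` is odd, a core
containing `{0} × P` remains. Usually the core is `{-t, 0, t} × P`, cut into `3 × 4` arrays
(`HasBlocks`). Stacking the pieces and concatenating arrays side by side gives the required size.

Blocks exist for every noncyclic `P` of order at least 16 (`TwoGroup.hasBlocks`): they extend across
a Klein four-group kernel, because multiplication by the three nonzero elements of the field with
four elements gives three bijections with sum zero. The base cases are finite tables and the family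
`ZMod 2 × ZMod (2 ^ f)`. Orders 4 and 8 are left; there the conditions force `β = 0`, and explicit
cores suffice. -/

/-- The elements of `S` are the entries, without repetition, of `c` arrays of size `a × b` all of
whose row and column sums vanish. -/
def IsTiled {Γ : Type*} [AddCommGroup Γ] (S : Set Γ) (a b c : ℕ) : Prop :=
  ∃ f : Fin c → Fin a → Fin b → Γ,
    Set.BijOn (fun t : Fin c × Fin a × Fin b => f t.1 t.2.1 t.2.2) Set.univ S ∧
    (∀ s i, ∑ j, f s i j = 0) ∧ ∀ s j, ∑ i, f s i j = 0

/-! ### Stacking, concatenating and transporting zero-sum tilings. -/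

namespace IsTiled

variable {Γ : Type*} [AddCommGroup Γ] {S T : Set Γ} {a a' b c : ℕ}

theorem of_fintype {I R C : Type*} [Fintype I] [Fintype R] [Fintype C]
    (hI : Fintype.card I = c) (hR : Fintype.card R = a) (hC : Fintype.card C = b)
    (f : I → R → C → Γ)
    (hf : Set.BijOn (fun t : I × R × C => f t.1 t.2.1 t.2.2) Set.univ S)
    (hrow : ∀ s i, ∑ j, f s i j = 0) (hcol : ∀ s j, ∑ i, f s i j = 0) : IsTiled S a b c := by
  let eI := (Fintype.equivFinOfCardEq hI).symm
  let eR := (Fintype.equivFinOfCardEq hR).symm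
  let eC := (Fintype.equivFinOfCardEq hC).symm
  refine ⟨fun s i j => f (eI s) (eR i) (eC j), ?_, fun s i => ?_, fun s j => ?_⟩
  · have h := (eI.prodCongr (eR.prodCongr eC)).bijective
    exact hf.comp (Set.bijOn_univ.2 h)
  · rw [← hrow (eI s) (eR i)]
    exact Equiv.sum_comp eC (fun j => f (eI s) (eR i) j)
  · rw [← hcol (eI s) (eC j)]
    exact Equiv.sum_comp eR (fun i => f (eI s) i (eC j))

theorem union (hS : IsTiled S a b c) (hT : IsTiled T a' b c) (hd : Disjoint S T) :
    IsTiled (S ∪ T) (a + a') b c := by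
  obtain ⟨f, hf, hfr, hfc⟩ := hS
  obtain ⟨g, hg, hgr, hgc⟩ := hT
  refine of_fintype (I := Fin c) (R := Fin a ⊕ Fin a') (C := Fin b) (by simp) (by simp) (by simp)
    (fun s i j => Sum.elim (fun i => f s i j) (fun i => g s i j) i) ?_ ?_ ?_
  · refine ⟨?_, ?_, ?_⟩
    · rintro ⟨s, i | i, j⟩ -
      · exact Or.inl (hf.mapsTo (Set.mem_univ (s, i, j)))
      · exact Or.inr (hg.mapsTo (Set.mem_univ (s, i, j)))
    · rintro ⟨s, i | i, j⟩ - ⟨s', i' | i', j'⟩ - h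
      · have := hf.injOn (Set.mem_univ (s, i, j)) (Set.mem_univ (s', i', j')) h
        simp_all
      · exact (hd.ne_of_mem (hf.mapsTo (Set.mem_univ (s, i, j)))
          (hg.mapsTo (Set.mem_univ (s', i', j'))) h).elim
      · exact (hd.ne_of_mem (hf.mapsTo (Set.mem_univ (s', i', j')))
          (hg.mapsTo (Set.mem_univ (s, i, j))) h.symm).elim
      · have := hg.injOn (Set.mem_univ (s, i, j)) (Set.mem_univ (s', i', j')) h
        simp_all
    · rintro x (hx | hx)
      · obtain ⟨⟨s, i, j⟩, -, h⟩ := hf.surjOn hx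
        exact ⟨(s, Sum.inl i, j), trivial, h⟩
      · obtain ⟨⟨s, i, j⟩, -, h⟩ := hg.surjOn hx
        exact ⟨(s, Sum.inr i, j), trivial, h⟩
  · rintro s (i | i)
    · exact hfr s i
    · exact hgr s i
  · intro s j
    simp [hfc, hgc]

theorem merge (r : ℕ) (hS : IsTiled S a b (r * c)) : IsTiled S a (r * b) c := by
  obtain ⟨f, hf, hfr, hfc⟩ := hS
  refine of_fintype (I := Fin c) (R := Fin a) (C := Fin r × Fin b) (by simp) (by simp) (by simp)
    (fun s i j => f (finProdFinEquiv (j.1, s)) i j.2) ?_ ?_ ?_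
  · let e : Fin c × Fin a × Fin r × Fin b ≃ Fin (r * c) × Fin a × Fin b :=
      { toFun := fun t => (finProdFinEquiv (t.2.2.1, t.1), t.2.1, t.2.2.2)
        invFun := fun t => ((finProdFinEquiv.symm t.1).2, t.2.1, (finProdFinEquiv.symm t.1).1, t.2.2)
        left_inv := fun t => by simp
        right_inv := fun t => Prod.ext (finProdFinEquiv.apply_symm_apply t.1) rfl }
    exact hf.comp (Set.bijOn_univ.2 e.bijective)
  · intro s i
    rw [Fintype.sum_prod_type]
    exact Finset.sum_eq_zero fun q _ => hfr (finProdFinEquiv (q, s)) i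
  · exact fun s j => hfc _ _

theorem map {Γ' : Type*} [AddCommGroup Γ'] (φ : Γ →+ Γ') (hφ : Set.InjOn φ S)
    (hS : IsTiled S a b c) : IsTiled (φ '' S) a b c := by
  obtain ⟨f, hf, hfr, hfc⟩ := hS
  refine ⟨fun s i j => φ (f s i j), (hφ.bijOn_image).comp hf, fun s i => ?_, fun s j => ?_⟩
  · rw [← map_sum, hfr, map_zero]
  · rw [← map_sum, hfc, map_zero]

theorem congr {Γ' : Type*} [AddCommGroup Γ'] (e : Γ ≃+ Γ') (h : IsTiled (Set.univ : Set Γ) a b c) :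
    IsTiled (Set.univ : Set Γ') a b c := by
  have := h.map e.toAddMonoidHom e.injective.injOn
  rwa [Set.image_univ, Set.range_eq_univ.2 (by exact e.surjective)] at this

theorem empty (b c : ℕ) : IsTiled (∅ : Set Γ) 0 b c :=
  ⟨fun _ i _ => i.elim0, ⟨fun t => t.2.1.elim0, fun t => t.2.1.elim0, fun _ h => h.elim⟩,
    fun _ i => i.elim0, fun _ _ => rfl⟩

theorem nonempty_magicRectangleSet (h : IsTiled (Set.univ : Set Γ) a b c) :
    Nonempty (MagicRectangleSet Γ a b c) := by
  obtain ⟨f, hf, hr, hc⟩ := h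
  exact ⟨⟨f, fun g => (Set.bijOn_univ.1 hf).existsUnique g, 0, 0, hr, hc⟩⟩

end IsTiled

/-! ### Lifting zero-sum arrays through quotients. -/

/-- An array whose row and column sums vanish in a quotient lifts to one with vanishing row and
column sums. -/
theorem exists_lift_array {P Q R C : Type*} [AddCommGroup P] [AddCommGroup Q] [Fintype R]
    [Fintype C] [Nonempty R] [Nonempty C] (ψ : P →+ Q) (hψ : Function.Surjective ψ)
    (f : R → C → Q) (hrow : ∀ i, ∑ j, f i j = 0) (hcol : ∀ j, ∑ i, f i j = 0) :
    ∃ g : R → C → P, (∀ i j, ψ (g i j) = f i j) ∧ (∀ i, ∑ j, g i j = 0) ∧ ∀ j, ∑ i, g i j = 0 := by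
  classical
  obtain ⟨i₀⟩ := ‹Nonempty R›
  obtain ⟨j₀⟩ := ‹Nonempty C›
  let g : R → C → P := fun i j => Function.surjInv hψ (f i j)
  have hg : ∀ i j, ψ (g i j) = f i j := fun i j => Function.surjInv_eq hψ _
  -- Row errors are absorbed in column `j₀` and column errors in row `i₀`; the corner then lost the
  -- total twice, so it is added back once. All corrections lie in the kernel.
  refine ⟨fun i j => g i j - (if j = j₀ then ∑ j', g i j' else 0)
    - (if i = i₀ then ∑ i', g i' j else 0)
    + (if i = i₀ then if j = j₀ then ∑ i', ∑ j', g i' j' else 0 else 0), ?_, ?_, ?_⟩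
  · intro i j
    have h1 : ψ (if j = j₀ then ∑ j', g i j' else 0) = 0 := by
      split_ifs <;> simp [hg, hrow]
    have h2 : ψ (if i = i₀ then ∑ i', g i' j else 0) = 0 := by
      split_ifs <;> simp [hg, hcol]
    have h3 : ψ (if i = i₀ then if j = j₀ then ∑ i', ∑ j', g i' j' else 0 else 0) = 0 := by
      split_ifs <;> simp [hg, hrow]
    rw [map_add, map_sub, map_sub, h1, h2, h3, hg]
    simp
  · intro i
    by_cases hi : i = i₀
    · simp [hi, sum_add_distrib, sum_sub_distrib, sum_comm (f := fun i' j => g i' j)]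
    · simp [hi, sum_sub_distrib]
  · intro j
    by_cases hj : j = j₀
    · simp [hj, sum_add_distrib, sum_sub_distrib]
    · simp [hj, sum_sub_distrib]

/-- Adding a family of permutations of the kernel to a system of representatives. -/
theorem bijective_add_kernel {P Q N J : Type*} [AddCommGroup P] [AddCommGroup Q] [AddCommGroup N]
    (φ : N →+ P) (hφ : Function.Injective φ) (ψ : P →+ Q)
    (hex : ∀ x, ψ x = 0 ↔ ∃ n, φ n = x) (x : J → P) (hx : Function.Bijective fun j => ψ (x j))
    (π : J → N → N) (hπ : ∀ j, Function.Bijective (π j)) :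
    Function.Bijective fun t : J × N => x t.1 + φ (π t.1 t.2) := by
  have h0 : ∀ n, ψ (φ n) = 0 := fun n => (hex _).2 ⟨n, rfl⟩
  constructor
  · rintro ⟨j, n⟩ ⟨j', n'⟩ h
    have h1 : ψ (x j) = ψ (x j') := by simpa [h0] using congrArg ψ h
    obtain rfl := hx.1 h1
    have h2 : φ (π j n) = φ (π j n') := add_left_cancel h
    rw [(hπ j).1 (hφ h2)]
  · intro p
    obtain ⟨j, hj⟩ := hx.2 (ψ p)
    obtain ⟨m, hm⟩ := (hex (p - x j)).1 (by rw [map_sub]; exact sub_eq_zero.2 hj.symm)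
    obtain ⟨n, rfl⟩ := (hπ j).2 m
    exact ⟨(j, n), by simp only [hm]; abel⟩

theorem exists_sign_sum_eq_zero {b : ℕ} (hb : Even b) :
    ∃ ε : Fin b → ℤ, (∀ j, ε j = 1 ∨ ε j = -1) ∧ ∑ j, ε j = 0 := by
  obtain ⟨k, rfl⟩ := hb
  rw [← two_mul, mul_comm]
  induction k with
  | zero => exact ⟨fun j => 1, fun j => Or.inl rfl, rfl⟩
  | succ k ih =>
    obtain ⟨ε, h1, h2⟩ := ih
    rw [show (k + 1) * 2 = k * 2 + 1 + 1 by ring]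
    refine ⟨Fin.cons 1 (Fin.cons (-1) ε : Fin (k * 2 + 1) → ℤ), ?_, ?_⟩
    · exact Fin.cons (Or.inl rfl) (Fin.cons (Or.inr rfl) h1)
    · rw [Fin.sum_univ_succ, Fin.sum_univ_succ]
      simp [h2]

/-- An odd number of signs cannot sum to zero, so one coefficient `-2` is used, in `1 + 1 - 2 = 0`.
Multiplication by 2 is still bijective on a group of odd order. -/
theorem exists_coeff_sum_eq_zero {a : ℕ} (ha : Odd a) (ha1 : 1 < a) :
    ∃ r : Fin a → ℤ, (∀ i, (r i).natAbs = 1 ∨ (r i).natAbs = 2) ∧ ∑ i, r i = 0 := by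
  obtain ⟨h, rfl⟩ : ∃ h, a = h * 2 + 3 := by
    obtain ⟨k, rfl⟩ := ha
    exact ⟨k - 1, by omega⟩
  clear ha ha1
  induction h with
  | zero => exact ⟨![1, 1, -2], by decide, by decide⟩
  | succ k ih =>
    obtain ⟨r, h1, h2⟩ := ih
    rw [show (k + 1) * 2 + 3 = k * 2 + 3 + 1 + 1 by ring]
    refine ⟨Fin.cons 1 (Fin.cons (-1) r : Fin (k * 2 + 3 + 1) → ℤ), ?_, ?_⟩
    · exact Fin.cons (Or.inl rfl) (Fin.cons (Or.inl rfl) h1)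
    · rw [Fin.sum_univ_succ, Fin.sum_univ_succ]
      simp [h2]

theorem bijective_zsmul_of_odd_card {N : Type*} [AddCommGroup N] (hN : Odd (Nat.card N)) {r : ℤ}
    (hr : r.natAbs = 1 ∨ r.natAbs = 2) : Function.Bijective fun n : N => r • n := by
  have hc : (Nat.card N).Coprime r.natAbs := by
    rcases hr with h | h <;> simp [h, hN]
  have h := Nat.Coprime.nsmul_right_bijective hc
  rcases Int.natAbs_eq r with h' | h' <;> rw [h']
  · simpa only [natCast_zsmul] using h
  · simp only [neg_smul, natCast_zsmul]
    exact (Equiv.neg N).bijective.comp h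

namespace IsTiled

/-- A tiling of a quotient by a subgroup of odd order can be lifted. -/
theorem of_odd_kernel {Γ Q N : Type*} [AddCommGroup Γ] [AddCommGroup Q] [AddCommGroup N] [Finite N]
    (φ : N →+ Γ) (hφ : Function.Injective φ) (ψ : Γ →+ Q) (hψ : Function.Surjective ψ)
    (hex : ∀ x, ψ x = 0 ↔ ∃ n, φ n = x) (hN : Odd (Nat.card N)) {a b c : ℕ} (ha : Odd a)
    (ha1 : 1 < a) (hb : Even b) (hb0 : 0 < b) (h : IsTiled (Set.univ : Set Q) a b c) :
    IsTiled (Set.univ : Set Γ) a b (c * Nat.card N) := by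
  have := Fintype.ofFinite N
  have : Nonempty (Fin a) := ⟨⟨0, by omega⟩⟩
  have : Nonempty (Fin b) := ⟨⟨0, by omega⟩⟩
  obtain ⟨f, hf, hfr, hfc⟩ := h
  choose g hg hgr hgc using fun s => exists_lift_array ψ hψ (f s) (hfr s) (hfc s)
  obtain ⟨ε, hε, hε0⟩ := exists_sign_sum_eq_zero hb
  obtain ⟨r, hr, hr0⟩ := exists_coeff_sum_eq_zero ha ha1
  -- The shift of cell `(i, j)` is `r i * ε j` times the kernel element: `ε` cancels it along rows,
  -- `r` along columns, and for a fixed cell it permutes the kernel.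
  refine of_fintype (I := Fin c × N) (R := Fin a) (C := Fin b) (by simp) (by simp) (by simp)
    (fun s i j => g s.1 i j + φ ((r i * ε j) • s.2)) ?_ ?_ ?_
  · rw [Set.bijOn_univ]
    have key := bijective_add_kernel φ hφ ψ hex
      (fun t : Fin c × Fin a × Fin b => g t.1 t.2.1 t.2.2)
      (by simpa only [hg] using Set.bijOn_univ.1 hf) (fun t n => (r t.2.1 * ε t.2.2) • n)
      (fun t => bijective_zsmul_of_odd_card hN (by
        rw [Int.natAbs_mul]
        rcases hε t.2.2 with h | h <;> simpa [h] using hr t.2.1))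
    let e : (Fin c × N) × Fin a × Fin b ≃ (Fin c × Fin a × Fin b) × N :=
      { toFun := fun t => ((t.1.1, t.2), t.1.2)
        invFun := fun t => ((t.1.1, t.2), t.1.2)
        left_inv := fun _ => rfl
        right_inv := fun _ => rfl }
    exact key.comp e.bijective
  · intro s i
    rw [sum_add_distrib, hgr, ← map_sum, ← sum_smul, ← mul_sum, hε0]
    simp
  · intro s j
    rw [sum_add_distrib, hgc, ← map_sum, ← sum_smul, ← sum_mul, hr0]
    simp

/-! ### Tiling the part of `Δ × P` over pairs `{d, -d}`. -/

theorem pair {Δ P : Type*} [AddCommGroup Δ] [AddCommGroup P] [Finite P]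
    (ψ : P →+ ZMod 2 × ZMod 2) (hψ : Function.Surjective ψ) {c : ℕ} (hc : Nat.card P = c * 4)
    (d : Δ) (hd : -d ≠ d) : IsTiled (({d, -d} : Set Δ) ×ˢ (Set.univ : Set P)) 2 4 c := by
  let q : Fin 4 → ZMod 2 × ZMod 2 := ![(0, 0), (0, 1), (1, 0), (1, 1)]
  have hq : Function.Bijective q := by decide
  -- The four elements of the Klein group sum to zero, and two equal rows sum to zero as well; only
  -- row 0 of the lift is used.
  obtain ⟨x, hx, hx0, -⟩ := exists_lift_array ψ hψ (fun (_ : Fin 2) j => q j) (by decide) (by decide)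
  -- The alternating signs cancel the kernel shift along a row.
  let ε : Fin 4 → ℤ := ![1, -1, 1, -1]
  let p : Fin 4 × ψ.ker → P := fun t => x 0 t.1 + ψ.ker.subtype (ε t.1 • t.2)
  have hp : Function.Bijective p := by
    refine bijective_add_kernel ψ.ker.subtype ψ.ker.subtype_injective ψ (fun y => ?_) (x 0)
      (by simpa only [hx] using hq) (fun j n => ε j • n) (fun j => ?_)
    · exact ⟨fun h => ⟨⟨y, h⟩, rfl⟩, by rintro ⟨n, rfl⟩; exact n.2⟩
    · have : ε j = 1 ∨ ε j = -1 := by revert j; decide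
      rcases this with h | h <;> rw [h]
      · simp only [one_smul]
        exact Function.bijective_id
      · simp only [neg_smul, one_smul]
        exact (Equiv.neg ψ.ker).bijective
  have hψp : ∀ t, ψ (p t) = q t.1 := by
    rintro ⟨j, n⟩
    have : ψ ((ε j • n : ψ.ker) : P) = 0 := (ε j • n : ψ.ker).2
    simp only [p, map_add, AddSubgroup.subtype_apply, this, hx, add_zero]
  have : Fintype ψ.ker := Fintype.ofFinite _
  have hcard : Fintype.card ψ.ker = c := by
    have := Nat.card_congr (Equiv.ofBijective p hp)
    rw [Nat.card_prod, hc, Nat.card_fin, Nat.card_eq_fintype_card] at this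
    omega
  -- The sign is `+` in two of the four columns and `-` in the other two, so the multiples of `d`
  -- cancel along rows. It depends only on a class modulo 2, hence is unchanged by `y ↦ -y`; so an
  -- element `(w • d, y)` determines its row `w * χ y`.
  let χ : P → ℤˣ := fun y => if (ψ y).1 = 0 then 1 else -1
  have hχ : ∀ (u : ℤˣ) y, χ (u • y) = χ y := by
    intro u y
    rcases Int.units_eq_one_or u with rfl | rfl <;> simp [χ]
  have hne : ∀ u v : ℤˣ, u • d = v • d → u = v := by
    intro u v h
    rcases Int.units_eq_one_or u with rfl | rfl <;> rcases Int.units_eq_one_or v with rfl | rfl <;>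
      simp_all [eq_comm]
  have huu : ∀ u : ℤˣ, u * u = 1 := Int.units_mul_self
  refine of_fintype (I := ψ.ker) (R := ℤˣ) (C := Fin 4) hcard (by simp) (by simp)
    (fun n u j => ((u * χ (p (j, n))) • d, u • p (j, n))) ⟨?_, ?_, ?_⟩ ?_ ?_
  · rintro ⟨n, u, j⟩ -
    refine ⟨?_, trivial⟩
    rcases Int.units_eq_one_or (u * χ (p (j, n))) with h | h <;> simp [h]
  · rintro ⟨n, u, j⟩ - ⟨n', u', j'⟩ - h
    simp only [Prod.mk.injEq] at h
    have h1 := hne _ _ h.1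
    have h2 := congrArg χ h.2
    rw [hχ, hχ] at h2
    rw [h2] at h1
    obtain rfl := mul_right_cancel h1
    have h3 := hp.1 ((MulAction.injective u) h.2)
    simp_all
  · rintro ⟨d', y⟩ ⟨hd', -⟩
    obtain ⟨w, rfl⟩ : ∃ w : ℤˣ, w • d = d' := by
      rcases hd' with rfl | rfl
      · exact ⟨1, one_smul _ _⟩
      · exact ⟨-1, by simp⟩
    obtain ⟨⟨j, n⟩, h⟩ := hp.2 ((w * χ y) • y)
    refine ⟨(n, w * χ y, j), trivial, ?_⟩
    simp only [h, hχ, mul_assoc, huu, mul_one, smul_smul, one_smul]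
  · intro n u
    have hχp : ∀ j, χ (p (j, n)) = if (q j).1 = 0 then 1 else -1 := fun j => by
      simp only [χ, hψp]
    have h1 : ∑ j, p (j, n) = 0 := by
      simp only [p, sum_add_distrib, hx0, ← map_sum, ← sum_smul]
      simp [ε, Fin.sum_univ_four]
    ext
    · simp only [hχp, Prod.fst_sum, Prod.fst_zero]
      simp [q, Fin.sum_univ_four, Units.smul_def]
    · simp only [Prod.snd_sum, ← smul_sum, h1, smul_zero, Prod.snd_zero]
  · intro n j
    rw [show (univ : Finset ℤˣ) = {1, -1} from rfl, sum_pair (by decide)]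
    ext <;> simp

theorem of_symmetric {Δ P : Type*} [AddCommGroup Δ] [AddCommGroup P] [Finite P]
    (ψ : P →+ ZMod 2 × ZMod 2) (hψ : Function.Surjective ψ) {c : ℕ} (hc : Nat.card P = c * 4)
    (D : Finset Δ) (hD : ∀ d ∈ D, -d ∈ D) (hD' : ∀ d ∈ D, -d ≠ d) :
    IsTiled ((D : Set Δ) ×ˢ (Set.univ : Set P)) D.card 4 c := by
  classical
  induction D using Finset.strongInduction with
  | H D ih =>
    rcases D.eq_empty_or_nonempty with rfl | ⟨d, hd⟩
    · simpa using empty 4 c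
    · have hsub : ({d, -d} : Finset Δ) ⊆ D := by
        intro y hy
        rcases Finset.mem_insert.1 hy with rfl | hy
        · exact hd
        · rw [Finset.mem_singleton.1 hy]; exact hD d hd
      have hpair : ({d, -d} : Finset Δ).card = 2 := card_pair (hD' d hd).symm
      have h1 := ih (D \ {d, -d}) (Finset.sdiff_ssubset hsub ⟨d, by simp⟩)
        (fun y hy => by
          simp only [mem_sdiff, mem_insert, mem_singleton, not_or] at hy ⊢
          exact ⟨hD y hy.1, fun h => hy.2.2 (by rw [← h, neg_neg]), fun h => hy.2.1 (neg_inj.1 h)⟩)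
        (fun y hy => hD' y (mem_sdiff.1 hy).1)
      have h2 := (pair ψ hψ hc d (hD' d hd)).union h1 (by
        rw [Set.disjoint_left]
        rintro ⟨y, z⟩ ⟨hy, -⟩ ⟨hy', -⟩
        simp at hy hy'
        tauto)
      rw [← Set.union_prod] at h2
      convert h2 using 1
      · congr 1
        ext y
        simp only [mem_coe, coe_sdiff, coe_insert, coe_singleton, Set.union_sdiff_self, Set.mem_union]
        exact ⟨Or.inr, fun h => h.elim (fun h => hsub (by simpa using h)) id⟩
      · rw [← hpair, ← card_union_of_disjoint disjoint_sdiff, union_sdiff_of_subset hsub]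

end IsTiled

/-! ### Blocks of size `3 × 4` and their extension. -/

/-- The involution of the rows `0, 1, 2` used in the four columns of a block: the last two rows are
exchanged in the last two columns. -/
def blockPerm : Fin 4 → Equiv.Perm (Fin 3) := ![1, 1, Equiv.swap 1 2, Equiv.swap 1 2]

theorem blockPerm_blockPerm (j : Fin 4) (i : Fin 3) : blockPerm j (blockPerm j i) = i := by
  revert i j; decide

/-- `P` admits a family of `3 × 4` arrays with vanishing row and column sums such that, for each
of the three types of cells (row `0`, row `1` up to `blockPerm`, row `2` up to `blockPerm`), the
cells of this type contain each element of `P` exactly once. -/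
def HasBlocks (P : Type*) [AddCommGroup P] : Prop :=
  ∃ (U : Type) (_ : Fintype U) (f : U → Fin 3 → Fin 4 → P),
    (∀ u i, ∑ j, f u i j = 0) ∧ (∀ u j, ∑ i, f u i j = 0) ∧
    ∀ k, Function.Bijective fun t : U × Fin 4 => f t.1 (blockPerm t.2 k) t.2

namespace HasBlocks

variable {P Q : Type*} [AddCommGroup P] [AddCommGroup Q]

theorem congr (e : P ≃+ Q) (h : HasBlocks P) : HasBlocks Q := by
  obtain ⟨U, hU, f, h1, h2, h3⟩ := h
  refine ⟨U, hU, fun u i j => e (f u i j), fun u i => ?_, fun u j => ?_, fun k => ?_⟩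
  · rw [← map_sum, h1, map_zero]
  · rw [← map_sum, h2, map_zero]
  · exact e.bijective.comp (h3 k)

theorem isTiled (h : HasBlocks P) {c : ℕ} (hc : Nat.card P = c * 4) :
    IsTiled (Set.Icc (-1) 1 ×ˢ Set.univ : Set (ℤ × P)) 3 4 c := by
  obtain ⟨U, hU, f, h1, h2, h3⟩ := h
  have hcard : Fintype.card U = c := by
    have := Nat.card_congr (Equiv.ofBijective _ (h3 0))
    rw [Nat.card_prod, hc, Nat.card_fin, Nat.card_eq_fintype_card] at this
    omega
  -- With these labels the rows of a block read `0,0,0,0`, then `1,1,-1,-1`, then `-1,-1,1,1`, and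
  -- each column contains `0, 1, -1`.
  let τ : Fin 3 → ℤ := ![0, 1, -1]
  have hτ : Function.Injective τ := by decide
  refine IsTiled.of_fintype (I := U) (R := Fin 3) (C := Fin 4) hcard (by simp) (by simp)
    (fun u i j => (τ (blockPerm j i), f u i j)) ⟨?_, ?_, ?_⟩ ?_ ?_
  · rintro ⟨u, i, j⟩ -
    refine ⟨?_, trivial⟩
    have : ∀ k, τ k ∈ Set.Icc (-1) 1 := by simp only [Set.mem_Icc]; decide
    exact this _
  · rintro ⟨u, i, j⟩ - ⟨u', i', j'⟩ - h
    simp only [Prod.mk.injEq] at h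
    have hk := hτ h.1
    have := @(h3 (blockPerm j i)).1 (u, j) (u', j') (by
      simp only [blockPerm_blockPerm]
      rw [hk, blockPerm_blockPerm, h.2])
    simp only [Prod.mk.injEq] at this
    obtain ⟨rfl, rfl⟩ := this
    rw [(blockPerm j).injective hk]
  · rintro ⟨t, y⟩ ⟨ht, -⟩
    obtain ⟨k, rfl⟩ : ∃ k, τ k = t := by
      obtain ⟨h, h'⟩ := ht
      simp only at h h'
      interval_cases t
      · exact ⟨2, rfl⟩
      · exact ⟨0, rfl⟩
      · exact ⟨1, rfl⟩
    obtain ⟨⟨u, j⟩, h⟩ := (h3 k).2 y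
    refine ⟨(u, blockPerm j k, j), trivial, ?_⟩
    simpa [blockPerm_blockPerm] using h
  · intro u i
    have : ∀ i, ∑ j, τ (blockPerm j i) = 0 := by decide
    ext
    · simpa only [Prod.fst_sum, Prod.fst_zero] using this i
    · simpa only [Prod.snd_sum, Prod.snd_zero] using h1 u i
  · intro u j
    have : ∀ j, ∑ i, τ (blockPerm j i) = 0 := by decide
    ext
    · simpa only [Prod.fst_sum, Prod.fst_zero] using this j
    · simpa only [Prod.snd_sum, Prod.snd_zero] using h2 u j

/-- Extension by a Klein four-group. -/
theorem of_klein_kernel (φ : ZMod 2 × ZMod 2 →+ P) (hφ : Function.Injective φ) (ψ : P →+ Q)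
    (hψ : Function.Surjective ψ) (hex : ∀ x, ψ x = 0 ↔ ∃ n, φ n = x) (h : HasBlocks Q) :
    HasBlocks P := by
  obtain ⟨U, hU, f, h1, h2, h3⟩ := h
  choose g hg hgr hgc using fun u => exists_lift_array ψ hψ (f u) (h1 u) (h2 u)
  -- These are the multiplications by `1, ω, ω²` in the field with four elements. They sum to zero
  -- down a column; along a row each type occurs an even number of times, and the characteristic is
  -- 2.
  let π : Fin 3 → ZMod 2 × ZMod 2 → ZMod 2 × ZMod 2 :=
    ![fun x => x, fun x => (x.2, x.1 + x.2), fun x => (x.1 + x.2, x.1)]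
  have hπ : ∀ k, Function.Bijective (π k) := by decide
  refine ⟨U × (ZMod 2 × ZMod 2), inferInstance,
    fun u i j => g u.1 i j + φ (π (blockPerm j i) u.2), fun u i => ?_, fun u j => ?_, fun k => ?_⟩
  · have : ∀ i n, ∑ j, π (blockPerm j i) n = 0 := by decide
    rw [sum_add_distrib, hgr, ← map_sum, this, map_zero, add_zero]
  · have : ∀ j n, ∑ i, π (blockPerm j i) n = 0 := by decide
    rw [sum_add_distrib, hgc, ← map_sum, this, map_zero, add_zero]
  · have key := bijective_add_kernel φ hφ ψ hex
      (fun t : U × Fin 4 => g t.1 (blockPerm t.2 k) t.2) (by simpa only [hg] using h3 k)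
      (fun _ => π k) (fun _ => hπ k)
    let e : (U × (ZMod 2 × ZMod 2)) × Fin 4 ≃ (U × Fin 4) × (ZMod 2 × ZMod 2) :=
      { toFun := fun t => ((t.1.1, t.2), t.1.2)
        invFun := fun t => ((t.1.1, t.2), t.1.2)
        left_inv := fun _ => rfl
        right_inv := fun _ => rfl }
    simp only [blockPerm_blockPerm]
    exact key.comp e.bijective

end HasBlocks

theorem exists_zmod_two_extension (a : ℕ) :
    ∃ (φ : ZMod 2 →+ ZMod (2 ^ (a + 1))) (ψ : ZMod (2 ^ (a + 1)) →+ ZMod (2 ^ a)),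
      Function.Injective φ ∧ Function.Surjective ψ ∧ ∀ x, ψ x = 0 ↔ ∃ n, φ n = x := by
  have hdvd : 2 ^ a ∣ 2 ^ (a + 1) := pow_dvd_pow 2 (Nat.le_succ a)
  have h0 : zmultiplesHom (ZMod (2 ^ (a + 1))) (2 ^ a) (2 : ℕ) = 0 := by
    have := ZMod.natCast_self (2 ^ (a + 1))
    push_cast at this
    simp [← this, pow_succ, mul_comm]
  let φ : ZMod 2 →+ ZMod (2 ^ (a + 1)) := ZMod.lift 2 ⟨zmultiplesHom _ (2 ^ a), h0⟩
  have hφ1 : φ 1 = 2 ^ a := by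
    have := ZMod.lift_coe 2 ⟨zmultiplesHom (ZMod (2 ^ (a + 1))) (2 ^ a), h0⟩ 1
    simpa using this
  have hval : ((2 ^ a : ℕ) : ZMod (2 ^ (a + 1))) ≠ 0 := by
    rw [Ne, ZMod.natCast_eq_zero_iff]
    exact fun h => absurd (Nat.le_of_dvd (by positivity) h)
      (not_le.2 (Nat.pow_lt_pow_right one_lt_two (Nat.lt_succ_self a)))
  refine ⟨φ, (ZMod.castHom hdvd (ZMod (2 ^ a))).toAddMonoidHom, ?_,
    ZMod.castHom_surjective hdvd, fun x => ⟨fun hx => ?_, ?_⟩⟩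
  · rw [injective_iff_map_eq_zero]
    intro n hn
    obtain rfl | rfl : n = 0 ∨ n = 1 := (by decide : ∀ n : ZMod 2, n = 0 ∨ n = 1) n
    · rfl
    · rw [hφ1] at hn
      exact (hval (by exact_mod_cast hn)).elim
  · obtain ⟨k, rfl⟩ := ZMod.natCast_zmod_surjective x
    have hk : ((k : ℕ) : ZMod (2 ^ a)) = 0 := by simpa using hx
    obtain ⟨q, rfl⟩ := (ZMod.natCast_eq_zero_iff _ _).1 hk
    refine ⟨(q : ZMod 2), ?_⟩
    rw [← nsmul_one q, map_nsmul, hφ1]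
    push_cast
    rw [nsmul_eq_mul, mul_comm]
  · rintro ⟨n, rfl⟩
    obtain rfl | rfl : n = 0 ∨ n = 1 := (by decide : ∀ n : ZMod 2, n = 0 ∨ n = 1) n
    · simp
    · rw [hφ1]
      have := ZMod.natCast_self (2 ^ a)
      have h2 := map_natCast (ZMod.castHom hdvd (ZMod (2 ^ a))) (2 ^ a)
      rw [this] at h2
      simpa using h2

/-- The kernel of the reduction is the Klein four-group generated by the elements of order 2 of the
two cyclic factors. -/
theorem HasBlocks.succ_succ {R : Type*} [AddCommGroup R] {a b : ℕ}
    (h : HasBlocks (ZMod (2 ^ a) × ZMod (2 ^ b) × R)) :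
    HasBlocks (ZMod (2 ^ (a + 1)) × ZMod (2 ^ (b + 1)) × R) := by
  obtain ⟨φ, ψ, h1, h2, h3⟩ := exists_zmod_two_extension a
  obtain ⟨φ', ψ', h1', h2', h3'⟩ := exists_zmod_two_extension b
  refine HasBlocks.of_klein_kernel
    (φ.prodMap ((AddMonoidHom.inl (ZMod (2 ^ (b + 1))) R).comp φ')) ?_
    (ψ.prodMap (ψ'.prodMap (AddMonoidHom.id R))) ?_ ?_ h
  · rintro ⟨x, y⟩ ⟨x', y'⟩ hxy
    simp only [AddMonoidHom.coe_prodMap, Prod.map_apply, AddMonoidHom.comp_apply,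
      AddMonoidHom.inl_apply, Prod.mk.injEq] at hxy
    rw [h1 hxy.1, h1' hxy.2.1]
  · exact h2.prodMap (h2'.prodMap Function.surjective_id)
  · rintro ⟨x, y, r⟩
    simp only [AddMonoidHom.coe_prodMap, Prod.map_apply, AddMonoidHom.id_apply, Prod.mk_eq_zero, h3,
      h3', AddMonoidHom.comp_apply, AddMonoidHom.inl_apply, Prod.mk.injEq, Prod.exists]
    constructor
    · rintro ⟨⟨m, hm⟩, ⟨n, hn⟩, rfl⟩
      exact ⟨m, n, hm, hn, rfl⟩
    · rintro ⟨m, n, hm, hn, rfl⟩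
      exact ⟨⟨m, hm⟩, ⟨n, hn⟩, rfl⟩

set_option maxHeartbeats 2000000 in
/-- The explicit blocks for `ZMod 2 × ZMod n` when `8 ∣ n`: in each of eight families of columns,
indexed by `Fin 2 × Fin 4`, the three entries run through arithmetic progressions of length
`n / 4`. -/
theorem HasBlocks.zmod_two_prod {n m : ℕ} (hm : 0 < m) (hn : n = 4 * (2 * m)) :
    HasBlocks (ZMod 2 × ZMod n) := by
  obtain ⟨h, hh⟩ : ∃ h : ℤ, h = 2 * m := ⟨_, rfl⟩
  let v : Fin 2 → Fin 4 → Fin 3 → ZMod 2 :=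
    ![![![0, 0, 0], ![1, 1, 0], ![1, 1, 0], ![0, 1, 1]],
      ![![0, 1, 1], ![1, 0, 1], ![0, 0, 0], ![1, 0, 1]]]
  -- The slopes cancel along the columns and, after `blockPerm`, along the rows. Types 0 and 2 have
  -- slope `±1` and fill intervals of length `h = n / 4`; type 1 has slope `±2` and fills even and
  -- odd residues separately, which works because `h` is even.
  let s : Fin 4 → Fin 3 → ℤ := ![![-1, 2, -1], ![1, -2, 1], ![1, -2, 1], ![-1, 2, -1]]
  let s' : Fin 4 → Fin 3 → ℤ := ![![-1, 2, -1], ![1, -2, 1], ![-1, 2, -1], ![1, -2, 1]]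
  let p : Fin 2 → Fin 4 → Fin 3 → ℤ :=
    ![![![0, h + 1, 3 * h - 1], ![0, 0, 0], ![3 * h, 2 * h, 3 * h], ![h, 3 * h + 1, -1]],
      ![![2 * h, h + 1, h - 1], ![2 * h, 0, 2 * h], ![3 * h, 3 * h + 1, 2 * h - 1],
        ![h, 2 * h, h]]]
  let w : Fin 2 → Fin (2 * m) → Fin 4 → Fin 3 → ℤ :=
    fun e i j k => p e j k + (![s, s'] e j k) * (i : ℤ)
  have hcast : ((4 * h : ℤ) : ZMod n) = 0 := by
    rw [ZMod.intCast_zmod_eq_zero_iff_dvd, hn]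
    exact ⟨1, by simp [hh]⟩
  have hzero : ∀ x : ℤ, 4 * h ∣ x → (x : ZMod n) = 0 := by
    rintro _ ⟨q, rfl⟩
    rw [Int.cast_mul, hcast, zero_mul]
  -- Two values differ by less than `7 * h < 2 * n`, so congruent ones differ by `-n`, `0` or `n`.
  have hbound : ∀ e i j k, -(2 * h) < w e i j k ∧ w e i j k < 5 * h := by
    intro e i j k
    have hi : (i : ℤ) < h := by have := i.2; omega
    have hi0 : (0 : ℤ) ≤ i := by positivity
    fin_cases e <;> fin_cases j <;> fin_cases k <;> simp [w, p, s, s'] <;> omega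
  have : NeZero n := ⟨by omega⟩
  refine ⟨Fin 2 × Fin (2 * m), inferInstance, fun u i j =>
    (v u.1 j (blockPerm j i), (w u.1 u.2 j (blockPerm j i) : ZMod n)), ?_, ?_, ?_⟩
  · rintro ⟨e, i⟩ r
    have h1 : ∀ e r, ∑ j, v e j (blockPerm j r) = 0 := by decide
    have h2 : 4 * h ∣ ∑ j, w e i j (blockPerm j r) := by
      rw [Fin.sum_univ_four]
      fin_cases e <;> fin_cases r <;> simp [w, p, s, s', blockPerm, Equiv.swap_apply_def] <;> first
        | exact ⟨0, by ring1⟩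
        | exact ⟨1, by ring1⟩
        | exact ⟨2, by ring1⟩
    ext
    · simpa only [Prod.fst_sum, Prod.fst_zero] using h1 e r
    · simpa only [Prod.snd_sum, Prod.snd_zero, ← Int.cast_sum] using hzero _ h2
  · rintro ⟨e, i⟩ j
    have h1 : ∀ e j, ∑ i, v e j (blockPerm j i) = 0 := by decide
    have h2 : 4 * h ∣ ∑ r, w e i j (blockPerm j r) := by
      rw [Equiv.sum_comp (blockPerm j) (w e i j), Fin.sum_univ_three]
      fin_cases e <;> fin_cases j <;> simp [w, p, s, s'] <;> first
        | exact ⟨0, by ring1⟩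
        | exact ⟨1, by ring1⟩
        | exact ⟨2, by ring1⟩
    ext
    · simpa only [Prod.fst_sum, Prod.fst_zero] using h1 e j
    · simpa only [Prod.snd_sum, Prod.snd_zero, ← Int.cast_sum] using hzero _ h2
  · intro k
    rw [Fintype.bijective_iff_injective_and_card]
    constructor
    · rintro ⟨⟨e, i⟩, j⟩ ⟨⟨e', i'⟩, j'⟩ heq
      simp only [blockPerm_blockPerm, Prod.mk.injEq] at heq
      obtain ⟨hv, hw⟩ := heq
      obtain ⟨q, hq⟩ := (ZMod.intCast_eq_intCast_iff_dvd_sub _ _ n).1 hw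
      have hn' : (n : ℤ) = 4 * h := by simp [hn, hh]
      rw [hn'] at hq
      have hb := hbound e i j k
      have hb' := hbound e' i' j' k
      have hpos : 0 < h := by omega
      have hq1 : q < 2 := by nlinarith
      have hq2 : -2 < q := by nlinarith
      have hx0 : (0 : ℤ) ≤ i := by positivity
      have hx0' : (0 : ℤ) ≤ i' := by positivity
      have hx : (i : ℤ) < h := by have := i.2; omega
      have hx' : (i' : ℤ) < h := by have := i'.2; omega
      suffices H : e = e' ∧ j = j' ∧ (i : ℤ) = i' by
        obtain ⟨rfl, rfl, H⟩ := H
        rw [Fin.ext (Int.ofNat_inj.1 H)]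
      have hq3 : q = -1 ∨ q = 0 ∨ q = 1 := by omega
      clear hb hb' hw hq1 hq2 hbound hzero hcast
      simp only [w] at hq
      generalize (i : ℤ) = x at *
      generalize (i' : ℤ) = x' at *
      fin_cases k <;> fin_cases e <;> fin_cases j <;> fin_cases e' <;> fin_cases j' <;>
        first
        | exact absurd hv (by decide)
        | (simp [p, s, s'] at hq ⊢
           rcases hq3 with rfl | rfl | rfl <;> omega)
    · simp [ZMod.card, hn]
      ring

/-! ### Abelian 2-groups given by lists of exponents, and their blocks. -/

/-- The product of the cyclic groups of order `2 ^ e`, for `e` in a list. -/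
def TwoGroup : List ℕ → Type
  | [] => Unit
  | e :: l => ZMod (2 ^ e) × TwoGroup l

namespace TwoGroup

instance instAddCommGroup : ∀ l, AddCommGroup (TwoGroup l)
  | [] => inferInstanceAs (AddCommGroup Unit)
  | e :: l =>
    let _ := instAddCommGroup l
    inferInstanceAs (AddCommGroup (ZMod (2 ^ e) × TwoGroup l))

instance instFintype : ∀ l, Fintype (TwoGroup l)
  | [] => inferInstanceAs (Fintype Unit)
  | e :: l =>
    let _ := instFintype l
    inferInstanceAs (Fintype (ZMod (2 ^ e) × TwoGroup l))

instance instDecidableEq : ∀ l, DecidableEq (TwoGroup l)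
  | [] => inferInstanceAs (DecidableEq Unit)
  | e :: l =>
    let _ := instDecidableEq l
    inferInstanceAs (DecidableEq (ZMod (2 ^ e) × TwoGroup l))

/-- The element whose coordinates are the digits of a natural number. -/
def ofNat : ∀ l, ℕ → TwoGroup l
  | [], _ => ()
  | e :: l, n => ((n : ZMod (2 ^ e)), ofNat l (n / 2 ^ e))

theorem nat_card : ∀ l, Nat.card (TwoGroup l) = 2 ^ l.sum
  | [] => Nat.card_unique (α := Unit)
  | e :: l => by
    have h : Nat.card (TwoGroup (e :: l)) = Nat.card (ZMod (2 ^ e)) * Nat.card (TwoGroup l) :=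
      Nat.card_prod _ _
    rw [h, nat_card l, Nat.card_zmod, List.sum_cons, pow_add]

theorem nonempty_addEquiv_of_perm {l l' : List ℕ} (h : l.Perm l') :
    Nonempty (TwoGroup l ≃+ TwoGroup l') := by
  induction h with
  | nil => exact ⟨AddEquiv.refl _⟩
  | cons x _ ih =>
    obtain ⟨e⟩ := ih
    exact ⟨(AddEquiv.refl (ZMod (2 ^ x))).prodCongr e⟩
  | swap x y l =>
    exact ⟨{ toFun := fun t => ((t.2.1, t.1, t.2.2) : ZMod (2 ^ x) × ZMod (2 ^ y) × TwoGroup l)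
             invFun := fun t => ((t.2.1, t.1, t.2.2) : ZMod (2 ^ y) × ZMod (2 ^ x) × TwoGroup l)
             left_inv := fun _ => rfl
             right_inv := fun _ => rfl
             map_add' := fun _ _ => rfl }⟩
  | trans _ _ ih ih' =>
    obtain ⟨e⟩ := ih
    obtain ⟨e'⟩ := ih'
    exact ⟨e.trans e'⟩

theorem nonempty_addEquiv_zero_cons (l : List ℕ) :
    Nonempty (TwoGroup l ≃+ TwoGroup (0 :: l)) := by
  have : Subsingleton (ZMod (2 ^ 0)) := inferInstanceAs (Subsingleton (ZMod 1))
  exact ⟨{ toFun := fun t => ((0, t) : ZMod (2 ^ 0) × TwoGroup l)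
           invFun := fun t => t.2
           left_inv := fun _ => rfl
           right_inv := fun _ => Prod.ext (Subsingleton.elim _ _) rfl
           map_add' := fun _ _ => Prod.ext (Subsingleton.elim _ _) rfl }⟩

theorem nonempty_pi_addEquiv_ofFn {k : ℕ} (e : Fin k → ℕ) :
    Nonempty (((i : Fin k) → ZMod (2 ^ e i)) ≃+ TwoGroup (List.ofFn e)) := by
  induction k with
  | zero =>
    exact ⟨{ toFun := fun _ => ()
             invFun := fun _ i => i.elim0
             left_inv := fun _ => funext fun i => i.elim0
             right_inv := fun _ => rfl
             map_add' := fun _ _ => rfl }⟩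
  | succ k ih =>
    obtain ⟨E⟩ := ih fun i => e i.succ
    rw [List.ofFn_succ]
    exact ⟨{ toFun := fun x => ((x 0, E fun i => x i.succ) :
               ZMod (2 ^ e 0) × TwoGroup (List.ofFn fun i => e i.succ))
             invFun := fun t => Fin.cons t.1 (E.symm t.2)
             left_inv := fun x => by
               refine funext fun i => Fin.cases rfl (fun i => ?_) i
               simp
             right_inv := fun t => by
               refine Prod.ext rfl ?_
               simp
             map_add' := fun x y => Prod.ext rfl (E.map_add _ _) }⟩

end TwoGroup

/-- Table entries are mixed-radix numbers whose least significant digit is the first coordinate. -/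
theorem HasBlocks.of_table {l : List ℕ} {n : ℕ} (T : Fin n → Fin 3 → Fin 4 → ℕ)
    (hrow : ∀ u i, ∑ j, TwoGroup.ofNat l (T u i j) = 0)
    (hcol : ∀ u j, ∑ i, TwoGroup.ofNat l (T u i j) = 0)
    (hbij : ∀ k, Function.Bijective
      fun t : Fin n × Fin 4 => TwoGroup.ofNat l (T t.1 (blockPerm t.2 k) t.2)) :
    HasBlocks (TwoGroup l) :=
  ⟨Fin n, inferInstance, fun u i j => TwoGroup.ofNat l (T u i j), hrow, hcol, hbij⟩

theorem hasBlocks_2_2 : HasBlocks (TwoGroup [2, 2]) :=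
  HasBlocks.of_table
    ![![![5, 15, 9, 11], ![8, 10, 12, 6], ![7, 15, 15, 7]],
      ![![3, 10, 7, 4], ![4, 11, 11, 14], ![13, 3, 6, 2]],
      ![![2, 14, 8, 12], ![14, 5, 9, 8], ![4, 1, 3, 12]],
      ![![0, 13, 1, 6], ![0, 13, 2, 5], ![0, 10, 1, 9]]]
    (by decide +kernel) (by decide +kernel) (by decide +kernel)

theorem hasBlocks_2_1_1 : HasBlocks (TwoGroup [2, 1, 1]) :=
  HasBlocks.of_table
    ![![![8, 12, 9, 15], ![7, 10, 10, 5], ![13, 6, 1, 8]],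
      ![![4, 10, 7, 11], ![9, 11, 9, 11], ![15, 3, 12, 2]],
      ![![2, 5, 6, 3], ![14, 3, 1, 14], ![12, 4, 5, 15]],
      ![![0, 13, 1, 14], ![0, 13, 7, 8], ![0, 2, 4, 6]]]
    (by decide +kernel) (by decide +kernel) (by decide +kernel)

theorem hasBlocks_1_1_1_1 : HasBlocks (TwoGroup [1, 1, 1, 1]) :=
  HasBlocks.of_table
    ![![![6, 11, 7, 10], ![8, 4, 10, 6], ![14, 15, 13, 12]],
      ![![3, 15, 4, 8], ![2, 7, 2, 7], ![1, 8, 6, 15]],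
      ![![2, 14, 5, 9], ![11, 3, 11, 3], ![9, 13, 14, 10]],
      ![![0, 13, 1, 12], ![0, 1, 4, 5], ![0, 12, 5, 9]]]
    (by decide +kernel) (by decide +kernel) (by decide +kernel)

theorem hasBlocks_3_2 : HasBlocks (TwoGroup [3, 2]) :=
  HasBlocks.of_table
    ![![![11, 16, 19, 26], ![29, 21, 12, 18], ![0, 3, 9, 28]],
      ![![9, 21, 22, 28], ![14, 7, 8, 19], ![17, 20, 10, 25]],
      ![![6, 25, 20, 29], ![20, 26, 2, 24], ![22, 21, 18, 19]],
      ![![5, 17, 14, 12], ![5, 22, 10, 11], ![6, 1, 16, 17]],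
      ![![4, 8, 18, 10], ![8, 6, 7, 27], ![28, 26, 23, 3]],
      ![![3, 15, 31, 7], ![15, 0, 4, 29], ![30, 25, 13, 12]],
      ![![1, 2, 24, 13], ![2, 31, 16, 31], ![5, 15, 24, 4]],
      ![![0, 27, 30, 23], ![27, 30, 9, 14], ![13, 23, 1, 11]]]
    (by decide +kernel) (by decide +kernel) (by decide +kernel)

theorem hasBlocks_3_1_1 : HasBlocks (TwoGroup [3, 1, 1]) :=
  HasBlocks.of_table
    ![![![12, 14, 22, 16], ![21, 12, 13, 18], ![31, 6, 29, 6]],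
      ![![11, 13, 19, 21], ![20, 23, 17, 20], ![25, 28, 4, 7]],
      ![![6, 10, 28, 20], ![31, 22, 0, 11], ![27, 24, 28, 25]],
      ![![5, 17, 9, 25], ![9, 0, 21, 26], ![10, 23, 26, 5]],
      ![![4, 8, 18, 26], ![8, 13, 19, 16], ![12, 3, 3, 14]],
      ![![3, 15, 31, 23], ![1, 15, 15, 1], ![4, 2, 18, 16]],
      ![![1, 2, 24, 29], ![2, 24, 22, 8], ![5, 30, 10, 19]],
      ![![0, 27, 30, 7], ![27, 30, 9, 14], ![29, 7, 17, 11]]]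
    (by decide +kernel) (by decide +kernel) (by decide +kernel)

theorem hasBlocks_2_2_1 : HasBlocks (TwoGroup [2, 2, 1]) :=
  HasBlocks.of_table
    ![![![12, 14, 16, 26], ![18, 6, 27, 5], ![22, 0, 9, 21]],
      ![![10, 23, 28, 11], ![29, 16, 16, 23], ![29, 13, 4, 22]],
      ![![6, 17, 20, 9], ![5, 0, 7, 8], ![9, 19, 25, 3]],
      ![![5, 13, 29, 21], ![17, 11, 11, 17], ![30, 12, 28, 14]],
      ![![4, 8, 18, 22], ![8, 26, 14, 20], ![4, 18, 20, 10]],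
      ![![3, 31, 7, 19], ![15, 13, 10, 2], ![6, 24, 7, 19]],
      ![![1, 2, 24, 25], ![2, 23, 28, 3], ![1, 31, 12, 24]],
      ![![0, 27, 30, 15], ![27, 30, 21, 26], ![25, 15, 1, 31]]]
    (by decide +kernel) (by decide +kernel) (by decide +kernel)

theorem hasBlocks_2_1_1_1 : HasBlocks (TwoGroup [2, 1, 1, 1]) :=
  HasBlocks.of_table
    ![![![16, 20, 23, 17], ![20, 9, 16, 15], ![4, 31, 5, 28]],
      ![![11, 14, 18, 21], ![3, 18, 2, 17], ![10, 28, 16, 6]],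
      ![![9, 26, 29, 12], ![19, 4, 6, 19], ![24, 30, 25, 29]],
      ![![5, 13, 22, 28], ![14, 7, 0, 11], ![9, 8, 22, 21]],
      ![![4, 8, 6, 10], ![8, 26, 21, 5], ![12, 18, 17, 13]],
      ![![3, 15, 31, 19], ![15, 0, 22, 27], ![14, 13, 11, 10]],
      ![![1, 2, 24, 25], ![2, 23, 20, 3], ![1, 23, 12, 24]],
      ![![0, 27, 30, 7], ![27, 30, 29, 26], ![25, 7, 1, 31]]]
    (by decide +kernel) (by decide +kernel) (by decide +kernel)

theorem hasBlocks_1_1_1_1_1 : HasBlocks (TwoGroup [1, 1, 1, 1, 1]) :=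
  HasBlocks.of_table
    ![![![22, 31, 23, 30], ![1, 4, 14, 11], ![23, 27, 25, 21]],
      ![![11, 15, 21, 17], ![31, 14, 19, 2], ![20, 1, 6, 19]],
      ![![6, 12, 19, 25], ![2, 10, 26, 18], ![4, 6, 9, 11]],
      ![![4, 26, 14, 16], ![26, 22, 16, 28], ![30, 12, 30, 12]],
      ![![3, 27, 18, 10], ![18, 27, 31, 22], ![17, 0, 13, 28]],
      ![![2, 7, 8, 13], ![7, 8, 7, 8], ![5, 15, 15, 5]],
      ![![1, 24, 5, 28], ![24, 0, 21, 13], ![25, 24, 16, 17]],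
      ![![0, 29, 20, 9], ![29, 20, 3, 10], ![29, 9, 23, 3]]]
    (by decide +kernel) (by decide +kernel) (by decide +kernel)

theorem HasBlocks.zmod_two_pow_two {f : ℕ} (hf : 3 ≤ f) : HasBlocks (TwoGroup [f, 1]) := by
  obtain ⟨E⟩ := TwoGroup.nonempty_addEquiv_of_perm (List.Perm.swap f 1 [])
  refine HasBlocks.congr E ?_
  have h : HasBlocks (ZMod 2 × ZMod (2 ^ f)) := by
    refine HasBlocks.zmod_two_prod (m := 2 ^ (f - 3)) (by positivity) ?_
    obtain ⟨g, rfl⟩ := Nat.exists_eq_add_of_le hf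
    rw [Nat.add_sub_cancel_left, pow_add]
    ring
  exact h.congr (AddEquiv.prodCongr (AddEquiv.refl _)
    { toFun := fun x => ((x, ()) : ZMod (2 ^ f) × Unit)
      invFun := fun x => x.1
      left_inv := fun _ => rfl
      right_inv := fun _ => rfl
      map_add' := fun _ _ => rfl })

/-- A noncyclic Abelian `2`-group of order at least `16` has blocks. -/
theorem TwoGroup.hasBlocks (l : List ℕ) (hpos : ∀ x ∈ l, 0 < x) (hsum : 4 ≤ l.sum)
    (hlen : 2 ≤ l.length) : HasBlocks (TwoGroup l) := by
  induction hn : l.sum using Nat.strong_induction_on generalizing l with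
  | _ n ih =>
  subst hn
  wlog hs : l.Pairwise (· ≥ ·) generalizing l with H
  · have hp := List.mergeSort_perm l (fun a b => decide (a ≥ b))
    obtain ⟨E⟩ := nonempty_addEquiv_of_perm hp
    refine HasBlocks.congr E (H _ (fun x hx => hpos x (hp.mem_iff.1 hx)) (hp.sum_eq ▸ hsum)
      (hp.length_eq ▸ hlen) (hp.sum_eq ▸ ih) ?_)
    have := List.pairwise_mergeSort (le := fun a b : ℕ => decide (a ≥ b))
      (fun a b c => by simp only [decide_eq_true_eq]; omega)
      (fun a b => by simp only [Bool.or_eq_true, decide_eq_true_eq]; omega) l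
    simpa using this
  obtain ⟨a, b, r, rfl⟩ : ∃ a b r, l = a :: b :: r := by
    match l, hlen with
    | a :: b :: r, _ => exact ⟨a, b, r, rfl⟩
  simp only [List.mem_cons, forall_eq_or_imp, List.sum_cons, List.length_cons,
    List.pairwise_cons] at hpos hsum hlen hs ih
  obtain ⟨ha, hb, hr⟩ := hpos
  obtain ⟨⟨hab, har⟩, hbr, hrr⟩ := hs
  obtain ⟨a, rfl⟩ := Nat.exists_eq_succ_of_ne_zero ha.ne'
  obtain ⟨b, rfl⟩ := Nat.exists_eq_succ_of_ne_zero hb.ne'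
  rw [Nat.succ_eq_add_one, Nat.succ_eq_add_one] at *
  have step : HasBlocks (TwoGroup (a :: b :: r)) → HasBlocks (TwoGroup ((a + 1) :: (b + 1) :: r)) :=
    fun h => HasBlocks.succ_succ (R := TwoGroup r) h
  -- Lowering two exponents by one lowers the sum by 2, so from 6 on the bound 4 survives. Exponents
  -- that become 0 are dropped; the quotient turns cyclic only for the list `[a + 1, 1]`, which the
  -- explicit family covers.
  by_cases h6 : 6 ≤ a + 1 + (b + 1 + r.sum)
  · rcases Nat.eq_zero_or_pos b with rfl | hb'
    · rcases Nat.eq_zero_or_pos a with rfl | ha'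
      -- As the list is decreasing, all exponents are 1, so `r` has at least four terms.
      · have hrs : r.sum ≤ r.length * 1 := List.sum_le_card_nsmul _ _ fun x hx => hbr x hx
        have h := ih r.sum (by omega) r hr (by omega) (by omega) rfl
        obtain ⟨E⟩ := nonempty_addEquiv_zero_cons r
        obtain ⟨E'⟩ := nonempty_addEquiv_zero_cons (0 :: r)
        exact step ((h.congr E).congr E')
      · cases r with
        | nil => exact HasBlocks.zmod_two_pow_two (by simp at h6; omega)
        | cons c r =>
          have h := ih (a :: c :: r).sum (by simp; omega) (a :: c :: r)
            (List.forall_mem_cons.2 ⟨ha', hr⟩) (by simp at h6 ⊢; omega) (by simp) rfl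
          obtain ⟨E⟩ := nonempty_addEquiv_zero_cons (a :: c :: r)
          obtain ⟨E'⟩ := nonempty_addEquiv_of_perm (List.Perm.swap a 0 (c :: r))
          exact step ((h.congr E).congr E')
    · exact step (ih (a :: b :: r).sum (by simp; omega) (a :: b :: r)
        (by simp only [List.mem_cons, forall_eq_or_imp]; exact ⟨by omega, hb', hr⟩)
        (by simp; omega) (by simp) rfl)
  · match r with
    | [] =>
      rcases Nat.eq_zero_or_pos b with rfl | hb'
      · exact HasBlocks.zmod_two_pow_two (by simp at hsum; omega)
      · simp only [List.sum_nil] at hsum h6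
        obtain ⟨rfl, rfl⟩ | ⟨rfl, rfl⟩ : a = 1 ∧ b = 1 ∨ a = 2 ∧ b = 1 := by omega
        · exact hasBlocks_2_2
        · exact hasBlocks_3_2
    | [c] =>
      simp at hsum h6 hr hbr har
      obtain ⟨rfl, rfl, rfl⟩ | ⟨rfl, rfl, rfl⟩ | ⟨rfl, rfl, rfl⟩ :
        a = 1 ∧ b = 0 ∧ c = 1 ∨ a = 2 ∧ b = 0 ∧ c = 1 ∨ a = 1 ∧ b = 1 ∧ c = 1 := by omega
      · exact hasBlocks_2_1_1
      · exact hasBlocks_3_1_1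
      · exact hasBlocks_2_2_1
    | [c, d] =>
      simp at hsum h6 hr hbr har
      obtain ⟨rfl, rfl, rfl, rfl⟩ | ⟨rfl, rfl, rfl, rfl⟩ :
        a = 0 ∧ b = 0 ∧ c = 1 ∧ d = 1 ∨ a = 1 ∧ b = 0 ∧ c = 1 ∧ d = 1 := by omega
      · exact hasBlocks_1_1_1_1
      · exact hasBlocks_2_1_1_1
    | [c, d, e] =>
      simp at hsum h6 hr hbr har
      obtain ⟨rfl, rfl, rfl, rfl, rfl⟩ : a = 0 ∧ b = 0 ∧ c = 1 ∧ d = 1 ∧ e = 1 := by omega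
      exact hasBlocks_1_1_1_1_1
    | c :: d :: e :: f :: r =>
      simp at hsum h6 hr
      omega

/-! ### Explicit cores for 2-parts of order 4 and 8. -/

theorem IsTiled.of_table {Δ : Type*} [AddCommGroup Δ] {l : List ℕ} {a b : ℕ} {D : Set Δ}
    (T : Fin a → Fin b → Δ × ℕ) (hmaps : ∀ i j, (T i j).1 ∈ D)
    (hinj : ∀ i j i' j', (T i j).1 = (T i' j').1 →
      TwoGroup.ofNat l (T i j).2 = TwoGroup.ofNat l (T i' j').2 → i = i' ∧ j = j')
    (hsurj : ∀ d ∈ D, ∀ p, ∃ i j, (T i j).1 = d ∧ TwoGroup.ofNat l (T i j).2 = p)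
    (hrow : ∀ i, ∑ j, (T i j).1 = 0 ∧ ∑ j, TwoGroup.ofNat l (T i j).2 = 0)
    (hcol : ∀ j, ∑ i, (T i j).1 = 0 ∧ ∑ i, TwoGroup.ofNat l (T i j).2 = 0) :
    IsTiled (D ×ˢ Set.univ : Set (Δ × TwoGroup l)) a b 1 := by
  refine ⟨fun _ i j => ((T i j).1, TwoGroup.ofNat l (T i j).2), ⟨?_, ?_, ?_⟩, ?_, ?_⟩
  · exact fun t _ => ⟨hmaps _ _, trivial⟩
  · rintro ⟨s, i, j⟩ - ⟨s', i', j'⟩ - h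
    simp only [Prod.mk.injEq] at h
    obtain ⟨rfl, rfl⟩ := hinj _ _ _ _ h.1 h.2
    rw [Subsingleton.elim s s']
  · rintro ⟨d, p⟩ ⟨hd, -⟩
    obtain ⟨i, j, rfl, rfl⟩ := hsurj d hd p
    exact ⟨(0, i, j), trivial, rfl⟩
  · intro s i
    ext
    · simpa only [Prod.fst_sum, Prod.fst_zero] using (hrow i).1
    · simpa only [Prod.snd_sum, Prod.snd_zero] using (hrow i).2
  · intro s j
    ext
    · simpa only [Prod.fst_sum, Prod.fst_zero] using (hcol j).1
    · simpa only [Prod.snd_sum, Prod.snd_zero] using (hcol j).2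

theorem IsTiled.of_int_table {l : List ℕ} {a b : ℕ} (r : ℤ) (T : Fin a → Fin b → ℤ × ℕ)
    (hmaps : ∀ i j, (T i j).1 ∈ Finset.Icc (-r) r)
    (hinj : ∀ i j i' j', (T i j).1 = (T i' j').1 →
      TwoGroup.ofNat l (T i j).2 = TwoGroup.ofNat l (T i' j').2 → i = i' ∧ j = j')
    (hsurj : ∀ d ∈ Finset.Icc (-r) r, ∀ p, ∃ i j, (T i j).1 = d ∧ TwoGroup.ofNat l (T i j).2 = p)
    (hrow : ∀ i, ∑ j, (T i j).1 = 0 ∧ ∑ j, TwoGroup.ofNat l (T i j).2 = 0)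
    (hcol : ∀ j, ∑ i, (T i j).1 = 0 ∧ ∑ i, TwoGroup.ofNat l (T i j).2 = 0) :
    IsTiled (Set.Icc (-r) r ×ˢ Set.univ : Set (ℤ × TwoGroup l)) a b 1 := by
  rw [← Finset.coe_Icc]
  exact .of_table T hmaps hinj hsurj hrow hcol

/-- The second row has first coordinates `1, 1, 0, 1`, whose sum vanishes only modulo 3; this core
therefore lives over `ZMod 3` rather than over the integers. -/
theorem isTiled_zmod_three : IsTiled (Set.univ : Set (ZMod 3 × TwoGroup [1, 1])) 3 4 1 := by
  rw [← Set.univ_prod_univ]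
  exact .of_table
    ![![(0, 0), (0, 1), (1, 3), (2, 2)],
      ![(1, 1), (1, 2), (0, 3), (1, 0)],
      ![(2, 1), (2, 3), (2, 0), (0, 2)]]
    (fun _ _ => trivial) (by decide +kernel) (fun d _ => by revert d; decide +kernel)
    (by decide +kernel) (by decide +kernel)

theorem isTiled_one_one : IsTiled (Set.Icc (-2) 2 ×ˢ Set.univ : Set (ℤ × TwoGroup [1, 1])) 5 4 1 :=
  .of_int_table 2
    ![![(-2, 0), (-1, 3), (2, 3), (1, 0)],
      ![(-2, 3), (2, 0), (0, 1), (0, 2)],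
      ![(1, 1), (2, 2), (-2, 2), (-1, 1)],
      ![(1, 3), (-2, 1), (1, 2), (0, 0)],
      ![(2, 1), (-1, 0), (-1, 2), (0, 3)]]
    (by decide +kernel) (by decide +kernel) (by decide +kernel) (by decide +kernel)
    (by decide +kernel)

theorem isTiled_one_two : IsTiled (Set.Icc (-1) 1 ×ˢ Set.univ : Set (ℤ × TwoGroup [1, 2])) 3 8 1 :=
  .of_int_table 1
    ![![(0, 4), (0, 3), (0, 5), (0, 6), (0, 7), (0, 0), (0, 2), (0, 1)],
      ![(-1, 4), (-1, 6), (-1, 3), (-1, 1), (1, 4), (1, 5), (1, 6), (1, 7)],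
      ![(1, 0), (1, 1), (1, 2), (1, 3), (-1, 7), (-1, 5), (-1, 0), (-1, 2)]]
    (by decide +kernel) (by decide +kernel) (by decide +kernel) (by decide +kernel)
    (by decide +kernel)

theorem isTiled_one_one_one :
    IsTiled (Set.Icc (-1) 1 ×ˢ Set.univ : Set (ℤ × TwoGroup [1, 1, 1])) 3 8 1 :=
  .of_int_table 1
    ![![(0, 4), (0, 7), (0, 0), (0, 3), (0, 5), (0, 6), (0, 1), (0, 2)],
      ![(-1, 4), (-1, 6), (-1, 2), (-1, 0), (1, 4), (1, 5), (1, 6), (1, 7)],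
      ![(1, 0), (1, 1), (1, 2), (1, 3), (-1, 1), (-1, 3), (-1, 7), (-1, 5)]]
    (by decide +kernel) (by decide +kernel) (by decide +kernel) (by decide +kernel)
    (by decide +kernel)

/-! ### Assembling the core, the symmetric pairs and the odd kernel. -/

/-- A finite Abelian group has subgroups of every order dividing its own. -/
theorem exists_addSubgroup_nat_card_eq {G : Type*} [AddCommGroup G] [Finite G] {d : ℕ}
    (hd : d ∣ Nat.card G) : ∃ H : AddSubgroup G, Nat.card H = d := by
  induction d using Nat.strong_induction_on generalizing G with
  | _ d ih =>
  have hG : 0 < Nat.card G := Nat.card_pos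
  have hd0 : 0 < d := Nat.pos_of_dvd_of_pos hd hG
  rcases Nat.lt_or_ge 1 d with h1 | h1
  · obtain ⟨p, hp, q, rfl⟩ := Nat.exists_prime_and_dvd h1.ne'
    have : Fact p.Prime := ⟨hp⟩
    obtain ⟨x, hx⟩ := exists_prime_addOrderOf_dvd_card' p ((Dvd.intro _ rfl).trans hd)
    have hcard := AddSubgroup.card_eq_card_quotient_mul_card_addSubgroup (AddSubgroup.zmultiples x)
    rw [Nat.card_zmultiples, hx] at hcard
    have hq : q ∣ Nat.card (G ⧸ AddSubgroup.zmultiples x) := by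
      rw [hcard, mul_comm] at hd
      exact Nat.dvd_of_mul_dvd_mul_right hp.pos hd
    have hq0 : 0 < q := Nat.pos_of_mul_pos_left hd0
    obtain ⟨H, hH⟩ := ih q (by nlinarith [hp.two_le]) hq
    refine ⟨H.comap (QuotientAddGroup.mk' _), ?_⟩
    have h1 := (H.comap (QuotientAddGroup.mk' (AddSubgroup.zmultiples x))).card_mul_index
    rw [AddSubgroup.index_comap_of_surjective _ (QuotientAddGroup.mk'_surjective _), hcard,
      ← H.card_mul_index, hH] at h1
    exact Nat.eq_of_mul_eq_mul_right (Nat.pos_of_ne_zero AddSubgroup.index_ne_zero_of_finite)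
      (h1.trans (by ring))
  · exact ⟨⊥, by rw [AddSubgroup.card_bot]; omega⟩

namespace IsTiled

/-- A tiling of a symmetric part of `Δ × P` containing `{0} × P` extends to all of `Δ × P`. -/
theorem extend_core {A Δ P : Type*} [AddCommGroup A] [AddCommGroup Δ] [AddCommGroup P] [Finite P]
    [Finite Δ] (hΔ : Odd (Nat.card Δ))
    (ψ : P →+ ZMod 2 × ZMod 2) (hψ : Function.Surjective ψ) {b c r : ℕ} (hb : b = r * 4)
    (hc : Nat.card P = b * c) (φ : A →+ Δ) (E : Finset A) (hφ : Set.InjOn φ E)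
    (hE0 : 0 ∈ E) (hE : ∀ x ∈ E, -x ∈ E)
    (h : IsTiled ((E : Set A) ×ˢ Set.univ : Set (A × P)) E.card b c) :
    IsTiled (Set.univ : Set (Δ × P)) (Nat.card Δ) b c := by
  classical
  have := Fintype.ofFinite Δ
  let D : Finset Δ := E.image φ
  have hD : IsTiled ((D : Set Δ) ×ˢ Set.univ : Set (Δ × P)) D.card b c := by
    have := h.map (φ.prodMap (AddMonoidHom.id P)) (by
      rintro ⟨x, y⟩ ⟨hx, -⟩ ⟨x', y'⟩ ⟨hx', -⟩ hxy
      simp only [AddMonoidHom.coe_prodMap, Prod.map_apply, AddMonoidHom.id_apply,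
        Prod.mk.injEq] at hxy
      exact Prod.ext (hφ hx hx' hxy.1) hxy.2)
    rw [AddMonoidHom.coe_prodMap, Set.prodMap_image_prod] at this
    rw [card_image_of_injOn hφ, coe_image]
    simpa using this
  have hneg : ∀ d : Δ, -d = d → d = 0 := by
    intro d hd
    have h2 : 2 • d = 0 := by rw [two_nsmul]; nth_rewrite 1 [← hd]; exact neg_add_cancel d
    have hinj := (Nat.Coprime.nsmul_right_bijective (G := Δ) (n := 2) (by simpa using hΔ)).1
    exact hinj (by simpa using h2)
  have hDneg : ∀ d, d ∈ D → -d ∈ D := by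
    intro d hd
    obtain ⟨x, hx, rfl⟩ := mem_image.1 hd
    exact mem_image.2 ⟨-x, hE x hx, map_neg _ _⟩
  have hrest := of_symmetric ψ hψ (c := r * c) (by rw [hc, hb]; ring) Dᶜ
    (fun d hd => by
      rw [mem_compl] at hd ⊢
      exact fun h => hd (by simpa using hDneg _ h))
    (fun d hd h => mem_compl.1 hd (by
      rw [hneg d h]
      exact mem_image.2 ⟨0, hE0, map_zero _⟩))
  have hrest' := hrest.merge r
  rw [← hb] at hrest'
  have := hD.union hrest' (by
    rw [Set.disjoint_left]
    rintro ⟨d, p⟩ ⟨hd, -⟩ ⟨hd', -⟩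
    simp at hd hd'
    exact hd' hd)
  rw [← Set.union_prod, coe_compl, Set.union_compl_self, Set.univ_prod_univ, card_add_card_compl,
    ← Nat.card_eq_fintype_card] at this
  exact this

/-- A core with sums zero in the integers keeps them under `x ↦ x • t`, so one table serves every
`Δ`; the order of `t` only has to keep the multiples from `-n` to `n` distinct. -/
theorem extend_int_core {Δ P : Type*} [AddCommGroup Δ] [AddCommGroup P] [Finite P]
    [Finite Δ] (hΔ : Odd (Nat.card Δ))
    (ψ : P →+ ZMod 2 × ZMod 2) (hψ : Function.Surjective ψ) {b c r : ℕ} (hb : b = r * 4)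
    (hc : Nat.card P = b * c) (n : ℕ) (t : Δ) (ht : 2 * n < addOrderOf t)
    (h : IsTiled (Set.Icc (-n : ℤ) n ×ˢ Set.univ : Set (ℤ × P)) (2 * n + 1) b c) :
    IsTiled (Set.univ : Set (Δ × P)) (Nat.card Δ) b c := by
  have hcard : (Finset.Icc (-n : ℤ) n).card = 2 * n + 1 := by
    rw [Int.card_Icc]; omega
  refine extend_core hΔ ψ hψ hb hc (zmultiplesHom Δ t) (Finset.Icc (-n) n) ?_ (by simp)
    (fun x hx => by simp only [Finset.mem_Icc] at hx ⊢; omega) (by rwa [hcard, coe_Icc])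
  intro x hx y hy hxy
  rw [coe_Icc, Set.mem_Icc] at hx hy
  have h0 : (x - y) • t = 0 := by
    rw [sub_smul, sub_eq_zero]
    simpa using hxy
  have hdvd := addOrderOf_dvd_iff_zsmul_eq_zero.2 h0
  have := Int.eq_zero_of_abs_lt_dvd hdvd (abs_lt.2 ⟨by omega, by omega⟩)
  omega

end IsTiled

theorem TwoGroup.exists_surjective (l : List ℕ) (hpos : ∀ x ∈ l, 0 < x) (hlen : 2 ≤ l.length) :
    ∃ ψ : TwoGroup l →+ ZMod 2 × ZMod 2, Function.Surjective ψ := by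
  match l, hlen with
  | x :: y :: r, _ =>
    have hx : 2 ∣ 2 ^ x := dvd_pow_self 2 (hpos x (by simp)).ne'
    have hy : 2 ∣ 2 ^ y := dvd_pow_self 2 (hpos y (by simp)).ne'
    let ψ : ZMod (2 ^ x) × (ZMod (2 ^ y) × TwoGroup r) →+ ZMod 2 × ZMod 2 :=
      (ZMod.castHom hx (ZMod 2)).toAddMonoidHom.prodMap
        ((ZMod.castHom hy (ZMod 2)).toAddMonoidHom.comp (AddMonoidHom.fst _ _))
    refine ⟨ψ, ?_⟩
    rintro ⟨u, v⟩
    obtain ⟨u', rfl⟩ := ZMod.castHom_surjective hx u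
    obtain ⟨v', rfl⟩ := ZMod.castHom_surjective hy v
    exact ⟨(u', v', 0), rfl⟩

theorem isTiled_prod_twoGroup {Δ : Type*} [AddCommGroup Δ] [Finite Δ] (hΔ : Odd (Nat.card Δ))
    (hΔ1 : 1 < Nat.card Δ) (l : List ℕ) (hpos : ∀ x ∈ l, 0 < x) (hlen : 2 ≤ l.length) {α β : ℕ}
    (hα : 2 ≤ α) (hsum : l.sum = α + β)
    (hl : 4 ≤ l.sum ∨ β = 0 ∧ (l = [1, 1] ∨ l = [1, 2] ∨ l = [1, 1, 1])) :
    IsTiled (Set.univ : Set (Δ × TwoGroup l)) (Nat.card Δ) (2 ^ α) (2 ^ β) := by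
  obtain ⟨ψ, hψ⟩ := TwoGroup.exists_surjective l hpos hlen
  have hb : 2 ^ α = 2 ^ (α - 2) * 4 := by
    obtain ⟨g, rfl⟩ := Nat.exists_eq_add_of_le hα
    rw [Nat.add_sub_cancel_left, pow_add]
    ring
  have hc : Nat.card (TwoGroup l) = 2 ^ α * 2 ^ β := by rw [TwoGroup.nat_card, hsum, pow_add]
  have : Nontrivial Δ := Finite.one_lt_card_iff_nontrivial.1 hΔ1
  obtain ⟨t, ht⟩ := exists_ne (0 : Δ)
  have hodd : Odd (addOrderOf t) := hΔ.of_dvd_nat (addOrderOf_dvd_natCard t)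
  have ht1 : addOrderOf t ≠ 1 := by rwa [Ne, AddMonoid.addOrderOf_eq_one_iff]
  have h3 : 2 * 1 < addOrderOf t := by obtain ⟨q, hq⟩ := hodd; omega
  rcases hl with hl | ⟨rfl, rfl | rfl | rfl⟩
  · have h := (TwoGroup.hasBlocks l hpos hl hlen).isTiled (c := 2 ^ (α - 2) * 2 ^ β)
      (by rw [hc, hb]; ring)
    have h := h.merge
    rw [← hb] at h
    exact IsTiled.extend_int_core hΔ ψ hψ hb hc 1 t h3 h
  · obtain rfl : α = 2 := by simp at hsum; omega
    -- If the order of `t` is not 3, it is odd and at least 5, which leaves room for the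
    -- five-element core.
    by_cases h5 : addOrderOf t = 3
    · have h0 : zmultiplesHom Δ t (3 : ℕ) = 0 := by
        simp [← h5]
      refine IsTiled.extend_core hΔ ψ hψ hb hc (ZMod.lift 3 ⟨zmultiplesHom Δ t, h0⟩)
        Finset.univ ?_ (mem_univ _) (fun _ _ => mem_univ _) ?_
      · refine Function.Injective.injOn ((ZMod.lift_injective _).2 fun n hn => ?_)
        rw [ZMod.intCast_zmod_eq_zero_iff_dvd, ← h5]
        exact addOrderOf_dvd_iff_zsmul_eq_zero.2 (by simpa using hn)
      · rw [coe_univ, Set.univ_prod_univ]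
        exact isTiled_zmod_three
    · exact IsTiled.extend_int_core hΔ ψ hψ hb hc 2 t (by obtain ⟨q, hq⟩ := hodd; omega)
        isTiled_one_one
  · obtain rfl : α = 3 := by simp at hsum; omega
    exact IsTiled.extend_int_core hΔ ψ hψ hb hc 1 t h3 isTiled_one_two
  · obtain rfl : α = 3 := by simp at hsum; omega
    exact IsTiled.extend_int_core hΔ ψ hψ hb hc 1 t h3 isTiled_one_one_one

theorem isTiled_prod_of_card_eq {Δ P : Type*} [AddCommGroup Δ] [AddCommGroup P] {a n b c : ℕ}
    (hΔ : Nat.card Δ = a * n) (hn : Odd n) (ha : Odd a) (ha1 : 1 < a) (hb : Even b) (hb0 : 0 < b)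
    (h : ∀ (K : AddSubgroup Δ), Nat.card (Δ ⧸ K) = a →
      IsTiled (Set.univ : Set ((Δ ⧸ K) × P)) a b c) :
    IsTiled (Set.univ : Set (Δ × P)) a b (c * n) := by
  have : Finite Δ := Nat.finite_of_card_ne_zero (by rw [hΔ]; have := hn.pos; positivity)
  obtain ⟨K, rfl⟩ := exists_addSubgroup_nat_card_eq (Dvd.intro_left a hΔ.symm)
  have hcard : Nat.card (Δ ⧸ K) = a := by
    have := AddSubgroup.card_eq_card_quotient_mul_card_addSubgroup K
    rw [hΔ] at this
    exact (Nat.eq_of_mul_eq_mul_right hn.pos this).symm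
  refine IsTiled.of_odd_kernel ((AddMonoidHom.inl Δ P).comp K.subtype) ?_
    ((QuotientAddGroup.mk' K).prodMap (AddMonoidHom.id P)) ?_ ?_ hn ha ha1 hb hb0 (h K hcard)
  · exact fun x y hxy => Subtype.ext (congrArg Prod.fst hxy)
  · exact (QuotientAddGroup.mk'_surjective K).prodMap Function.surjective_id
  · rintro ⟨x, y⟩
    simp only [AddMonoidHom.coe_prodMap, Prod.map_apply, QuotientAddGroup.mk'_apply,
      AddMonoidHom.id_apply, Prod.mk_eq_zero, QuotientAddGroup.eq_zero_iff,
      AddMonoidHom.comp_apply, AddSubgroup.subtype_apply, AddMonoidHom.inl_apply, Prod.mk.injEq]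
    constructor
    · rintro ⟨hx, rfl⟩
      exact ⟨⟨x, hx⟩, rfl, rfl⟩
    · rintro ⟨k, rfl, rfl⟩
      exact ⟨k.2, rfl⟩

theorem theorem3p7 (a α β m c k : ℕ) (ha : Odd a) (ha1 : 1 < a) (hb : 2 < 2 ^ α)
    (hc : c = 2 ^ β * (2 * m + 1)) (hk : 1 < k)
    (e : Fin k → ℕ) (he_pos : ∀ i, 1 ≤ e i) (he_mono : Monotone e)
    (he_sum : ∑ i, e i = α + β)
    (Δ : Type*) [AddCommGroup Δ] (hΔ : Nat.card Δ = a * (2 * m + 1))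
    (Γ : Type*) [AddCommGroup Γ] (hΓ : Nonempty (Γ ≃+ Δ × ((i : Fin k) → ZMod (2 ^ e i))))
    (hcond : 1 < e ⟨0, by omega⟩ ∨ (∃ h : 2 < k, 1 < e ⟨2, h⟩) ∨ 3 < k ∨ Odd c) :
    Nonempty (MagicRectangleSet Γ a (2 ^ α) c) := by
  obtain ⟨E⟩ := hΓ
  obtain ⟨E'⟩ := TwoGroup.nonempty_pi_addEquiv_ofFn e
  have hα : 2 ≤ α := by
    by_contra! h
    have := Nat.pow_le_pow_right two_pos (Nat.le_of_lt_succ h)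
    omega
  have hl : 4 ≤ (List.ofFn e).sum ∨
      β = 0 ∧ (List.ofFn e = [1, 1] ∨ List.ofFn e = [1, 2] ∨ List.ofFn e = [1, 1, 1]) := by
    rw [List.sum_ofFn, or_iff_not_imp_left, not_le]
    -- An exponent sum below 4 forces `k ≤ 3`, least exponent 1 if `k = 2`, and all exponents 1 if
    -- `k = 3`. The first three conditions then fail, so `c` is odd and `β = 0`.
    intro h4
    have hodd : Odd c → β = 0 := by
      intro h
      by_contra hβ
      rw [hc] at h
      exact Nat.not_even_iff_odd.2 h ((even_two.pow_of_ne_zero hβ).mul_right _)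
    have hk3 : k ≤ ∑ i, e i := by
      simpa using Finset.card_nsmul_le_sum univ e 1 fun i _ => he_pos i
    obtain rfl | rfl : k = 2 ∨ k = 3 := by omega
    · rw [Fin.sum_univ_two] at h4
      have h0 := he_pos 0
      have h1 := he_pos 1
      have h01 := he_mono (show (0 : Fin 2) ≤ 1 by decide)
      have h0' : ¬1 < e ⟨0, by omega⟩ := by change ¬1 < e 0; omega
      refine ⟨hodd (by simpa only [h0', IsEmpty.exists_iff, show ¬2 < 2 by decide, show ¬3 < 2 by decide,
        false_or] using hcond), ?_⟩
      simp [List.ofFn_succ]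
      omega
    · rw [Fin.sum_univ_three] at h4
      have h0 := he_pos 0
      have h1 := he_pos 1
      have h2 := he_pos 2
      have h0' : ¬1 < e ⟨0, by omega⟩ := by change ¬1 < e 0; omega
      have h2' : ∀ h, ¬1 < e ⟨2, h⟩ := by intro h; change ¬1 < e 2; omega
      refine ⟨hodd (by simpa only [h0', h2', exists_const, exists_false, show ¬3 < 3 by decide,
        false_or] using hcond), ?_⟩
      simp [List.ofFn_succ]
      omega
  have key : IsTiled (Set.univ : Set (Δ × TwoGroup (List.ofFn e))) a (2 ^ α)
      (2 ^ β * (2 * m + 1)) := by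
    refine isTiled_prod_of_card_eq hΔ ⟨m, rfl⟩ ha ha1 (even_two.pow_of_ne_zero (by omega))
      (by positivity) fun K hK => ?_
    have : Finite (Δ ⧸ K) := Nat.finite_of_card_ne_zero (by omega)
    have := isTiled_prod_twoGroup (Δ := Δ ⧸ K) (hK ▸ ha) (hK ▸ ha1) (List.ofFn e)
      (List.forall_mem_ofFn_iff.2 he_pos) (by rw [List.length_ofFn]; exact hk) hα
      (by rw [List.sum_ofFn, he_sum]) hl
    rwa [hK] at this
  rw [hc]
  exact (key.congr (E.trans ((AddEquiv.refl Δ).prodCongr E')).symm).nonempty_magicRectangleSet
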